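/- Let $\mathbb{K}$ be an algebraically closed field of characteristic $0$ (for example $\mathbb{C}$), let $2\le k<n$, and let $v_1,\dots,v_n$ be a basis of an $n$-dimensional $\mathbb{K}$-vector space $V$. Let $\mathbb{S}_{(2,1^{k-1})}V\subset \bigwedge^k V\otimes V$ be the Schur module of the partition $(2,1^{k-1})$, i.e. the image of the Young symmetrizer, which is the linear span of the elements $u_1\wedge\dots\wedge u_k\otimes y+y\wedge u_2\wedge\dots\wedge u_k\otimes u_1$ with $u_1,\dots,u_k,y\in V$. Let $\mathbb{F}\subset\mathbb{P}(\mathbb{S}_{(2,1^{k-1})}V)$ be the flag variety $\mathbb{F}(1,k;V)$, i.e. the set of points $[u_1\wedge\dots\wedge u_k\otimes u_1]$ with $u_1,\dots,u_k\in V$ linearly independent. The $(2,1^{k-1})$-rank of a nonzero $t\in\mathbb{S}_{(2,1^{k-1})}V$ is the least $r$ such that $[t]$ lies in the projective span of $r$ points of $\mathbb{F}$. Let $i\in\{2,\dots,k\}$ and $h\in\{2,\dots,n\}$, let $w$ be a nonzero vector of $\langle v_{k+1},\dots,v_n\rangle$ (for example $w=v_j$ with $j\in\{k+1,\dots,n\}$),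 let $a,b\in\mathbb{K}\setminus\{0\}$, and consider $$t=a\cdot v_1\wedge\dots\wedge v_{i-1}\wedge w\wedge v_{i+1}\wedge\dots\wedge v_k\otimes v_1+b\cdot\left(v_1\wedge\dots\wedge v_k\otimes v_h+v_h\wedge v_2\wedge\dots\wedge v_k\otimes v_1\right).$$ Then $t$ is a nonzero element of $\mathbb{S}_{(2,1^{k-1})}V$, and its $(2,1^{k-1})$-rank is (i) $2$ if $w$ and $v_h$ are not proportional and $v_h\in\langle v_2,\dots,v_k\rangle$; (ii) $3$ if $w$ and $v_h$ are not proportional and $v_h\notin\langle v_2,\dots,v_k\rangle$; (iii) $2$ if $w$ and $v_h$ are proportional. -/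

import Mathlib

open scoped TensorProduct LinearAlgebra.Projectivization

/-- The `X`-rank of a point `p` of the projective space `ℙ(W)`: the least `r` such that `p` lies in
the projective span of `r` points of `X` (`⊤` if there is no such `r`). -/
noncomputable def xRank {K W : Type*} [Field K] [AddCommGroup W] [Module K W]
    (X : Set (ℙ K W)) (p : ℙ K W) : ℕ∞ :=
  ⨅ (r : ℕ) (_ : ∃ q : Fin r → ℙ K W, (∀ s, q s ∈ X) ∧
    p ∈ Projectivization.Subspace.span (Set.range q)), (r : ℕ∞)

/-- The wedge product `u_1 ∧ ⋯ ∧ u_k` in `⋀^k V`. Here and below a list `u_1, …, u_k` is a map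
`u : Fin k → V`, so that `u_1` is `u 0`. -/
noncomputable abbrev wedge (K : Type*) {V : Type*} [Field K] [AddCommGroup V] [Module K V] {k : ℕ}
    (u : Fin k → V) : ⋀[K]^k V :=
  exteriorPower.ιMulti K k u

/-- The element `u_1 ∧ ⋯ ∧ u_k ⊗ w + w ∧ u_2 ∧ ⋯ ∧ u_k ⊗ u_1` of `⋀^k V ⊗ V`. It is the image of
`u_1 ⊗ ⋯ ⊗ u_k ⊗ w` under the Young symmetrizer of the standard tableau of shape `(2, 1^{k-1})` with
first column `1, …, k` and with `k + 1` in the remaining box: one first symmetrizes over the row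
`{1, k + 1}`, and then antisymmetrizes over the column `{1, …, k}`, which gives the wedges. -/
noncomputable def hookSymm (K : Type*) {V : Type*} [Field K] [AddCommGroup V] [Module K V] {k : ℕ}
    [NeZero k] (u : Fin k → V) (w : V) : (⋀[K]^k V) ⊗[K] V :=
  wedge K u ⊗ₜ[K] w + wedge K (Function.update u 0 w) ⊗ₜ[K] u 0

/-- The Schur module `𝕊_{(2, 1^{k-1})} V ⊆ ⋀^k V ⊗ V`: the image of the Young symmetrizer, that is,
the linear span of its values on the pure tensors. -/
noncomputable def hookSchur (K V : Type*) [Field K] [AddCommGroup V] [Module K V] (k : ℕ)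
    [NeZero k] : Submodule K ((⋀[K]^k V) ⊗[K] V) :=
  Submodule.span K {x | ∃ (u : Fin k → V) (w : V), x = hookSymm K u w}

/-- A linear subspace of `⋀^k V ⊗ V` is an additive group, with the inherited operations. (Instance
search does not find this by itself.) -/
noncomputable instance instAddCommGroupSubTensor {K V : Type*} [Field K] [AddCommGroup V]
    [Module K V] {k : ℕ} (S : Submodule K ((⋀[K]^k V) ⊗[K] V)) : AddCommGroup S :=
  @Submodule.addCommGroup K ((⋀[K]^k V) ⊗[K] V) _ TensorProduct.addCommGroup
    TensorProduct.leftModule S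

theorem flagTensor_mem {K V : Type*} [Field K] [CharZero K] [AddCommGroup V] [Module K V] {k : ℕ}
    [NeZero k] (u : Fin k → V) : wedge K u ⊗ₜ[K] u 0 ∈ hookSchur K V k := by
  have h : hookSymm K u (u 0) ∈ hookSchur K V k := Submodule.subset_span ⟨u, u 0, rfl⟩
  have h2 := (hookSchur K V k).smul_mem (2⁻¹ : K) h
  have e : (2⁻¹ : K) • hookSymm K u (u 0) = wedge K u ⊗ₜ[K] u 0 := by
    rw [hookSymm, Function.update_eq_self, ← two_smul K, smul_smul,
      inv_mul_cancel₀ two_ne_zero, one_smul]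
  rwa [e] at h2

theorem flagTensor_ne_zero {K V : Type*} [Field K] [AddCommGroup V] [Module K V] {k : ℕ}
    [NeZero k] (u : Fin k → V) (hu : LinearIndependent K u) :
    wedge K u ⊗ₜ[K] u 0 ≠ (0 : (⋀[K]^k V) ⊗[K] V) := by
  obtain ⟨g, hg⟩ := (Fintype.linearCombination K u).exists_leftInverse_of_injective
    (LinearMap.ker_eq_bot.2 hu.fintypeLinearCombination_injective)
  have hgu : ∀ s, g (u s) = Pi.single s 1 := fun s => by
    have := LinearMap.congr_fun hg (Pi.single s 1)
    simpa [Fintype.linearCombination_apply_single] using this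
  let D : V [⋀^Fin k]→ₗ[K] K := Matrix.detRowAlternating.compLinearMap g
  have hD : exteriorPower.alternatingMapLinearEquiv D (wedge K u) = 1 := by
    rw [exteriorPower.alternatingMapLinearEquiv_apply_ιMulti]
    have : (fun s => g (u s)) = (1 : Matrix (Fin k) (Fin k) K) := by
      ext s t
      rw [hgu, Matrix.one_apply, Pi.single_apply]
      simp [eq_comm]
    change Matrix.det (fun s => g (u s)) = 1
    rw [this, Matrix.det_one]
  intro h
  have h1 := congrArg (TensorProduct.lift ((LinearMap.mul K K).compl₁₂
    (exteriorPower.alternatingMapLinearEquiv D) (LinearMap.proj 0 ∘ₗ g))) h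
  rw [TensorProduct.lift.tmul, LinearMap.compl₁₂_apply, hD, map_zero] at h1
  simp [hgu] at h1

/-- The point `[u_1 ∧ ⋯ ∧ u_k ⊗ u_1]` of `ℙ(𝕊_{(2, 1^{k-1})} V)`, which represents the flag
`⟨u_1⟩ ⊆ ⟨u_1, …, u_k⟩`. -/
noncomputable def flagPoint {K V : Type*} [Field K] [CharZero K] [AddCommGroup V] [Module K V]
    {k : ℕ} [NeZero k] (u : Fin k → V) (hu : LinearIndependent K u) : ℙ K (hookSchur K V k) :=
  Projectivization.mk K ⟨wedge K u ⊗ₜ[K] u 0, flagTensor_mem u⟩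
    fun h => flagTensor_ne_zero u hu (congrArg Subtype.val h)

/-- The flag variety `𝔽(1, k; V)`, embedded in `ℙ(𝕊_{(2, 1^{k-1})} V)`. -/
def flagVariety (K V : Type*) [Field K] [CharZero K] [AddCommGroup V] [Module K V] (k : ℕ)
    [NeZero k] : Set (ℙ K (hookSchur K V k)) :=
  {p | ∃ (u : Fin k → V) (hu : LinearIndependent K u), p = flagPoint u hu}

/-- `t` is a nonzero element of the Schur module `𝕊_{(2, 1^{k-1})} V`, and the point of
`ℙ(𝕊_{(2, 1^{k-1})} V)` that it determines has `(2, 1^{k-1})`-rank `r`. -/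
def HasHookRank {K V : Type*} [Field K] [CharZero K] [AddCommGroup V] [Module K V] {k : ℕ}
    [NeZero k] (t : (⋀[K]^k V) ⊗[K] V) (r : ℕ) : Prop :=
  ∃ (ht : t ∈ hookSchur K V k) (h0 : (⟨t, ht⟩ : hookSchur K V k) ≠ 0),
    xRank (flagVariety K V k) (Projectivization.mk K ⟨t, ht⟩ h0) = r

/-- The tensor
`a · u_1 ∧ ⋯ ∧ u_{i-1} ∧ w ∧ u_{i+1} ∧ ⋯ ∧ u_k ⊗ u_1`
`  + b · (u_1 ∧ ⋯ ∧ u_k ⊗ y + y ∧ u_2 ∧ ⋯ ∧ u_k ⊗ u_1)`. -/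
noncomputable def tangentTensor {K V : Type*} [Field K] [AddCommGroup V] [Module K V] {k : ℕ}
    [NeZero k] (u : Fin k → V) (i : Fin k) (w y : V) (a b : K) : (⋀[K]^k V) ⊗[K] V :=
  a • (wedge K (Function.update u i w) ⊗ₜ[K] u 0) +
    b • (wedge K u ⊗ₜ[K] y + wedge K (Function.update u 0 y) ⊗ₜ[K] u 0)

section SpanOfPoints

variable {K W : Type*} [Field K] [AddCommGroup W] [Module K W]

/-! Choosing representatives turns rank into the least length of a linear combination of flag
tensors (`IsFlagSum`). Write `t = A ⊗ u_1 + B ⊗ v_h`, with `B = b · u_1 ∧ ⋯ ∧ u_k` and `A` the sum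
of the two wedges that contain `w` and `v_h`.

Upper bounds: the first summand of `t` is one flag tensor when `w` and `v_h` are independent, and
polarization makes the symmetrized summand a combination of two if `v_h` lies outside `⟨u_1, …,
u_k⟩`. This gives 3. If `v_h = u_j` with `j ≠ 1`, the term `v_h ∧ u_2 ∧ ⋯ ∧ u_k` vanishes and one
flag tensor remains for the second summand. If `w` is proportional to `v_h`, replacing `u_i` by `u_i
- λ u_1` absorbs the first summand into the second.

Lower bounds: `A` and `B` are independent, so `t` is not a pure tensor. In case (ii), contracting a
combination of two flag tensors yields decomposable elements of `⟨A, B⟩`; the minor relation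
`minor_update_update_eq_zero` shows that these are all multiples of `B`, which forces `B = 0`. -/

theorem mk_mem_span_range_iff {ι : Type*} (x : ι → W) (hx : ∀ s, x s ≠ 0) {y : W} (hy : y ≠ 0) :
    Projectivization.mk K y hy ∈ Projectivization.Subspace.span
        (Set.range fun s => Projectivization.mk K (x s) (hx s)) ↔
      y ∈ Submodule.span K (Set.range x) := by
  constructor
  · intro h
    have hle : Projectivization.Subspace.span
        (Set.range fun s => Projectivization.mk K (x s) (hx s)) ≤
        (Submodule.span K (Set.range x)).projectivization := by
      rw [Projectivization.Subspace.span_le_subspace_iff]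
      rintro _ ⟨s, rfl⟩
      exact (Submodule.mk_mem_projectivization_iff _ (hx s)).2
        (Submodule.subset_span (Set.mem_range_self s))
    exact (Submodule.mk_mem_projectivization_iff _ hy).1 (hle h)
  · intro h
    rw [← Projectivization.Subspace.mem_submodule_iff]
    refine (Submodule.span_le.2 ?_ : Submodule.span K (Set.range x) ≤ _) h
    rintro _ ⟨s, rfl⟩
    exact (Projectivization.Subspace.mem_submodule_iff _ (hx s)).2
      (Projectivization.Subspace.subset_span _ (Set.mem_range_self s))

end SpanOfPoints

/-! ### Rank as the length of a combination of flag tensors -/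

section

variable {K V : Type*} [Field K] [AddCommGroup V] [Module K V] {k : ℕ}

/-- `t` is a linear combination of `r` tensors `u_1 ∧ ⋯ ∧ u_k ⊗ u_1` with `u_1, …, u_k` linearly
independent. -/
def IsFlagSum [NeZero k] (t : (⋀[K]^k V) ⊗[K] V) (r : ℕ) : Prop :=
  ∃ (c : Fin r → K) (p : Fin r → Fin k → V), (∀ s, LinearIndependent K (p s)) ∧
    t = ∑ s, c s • (wedge K (p s) ⊗ₜ[K] p s 0)

theorem IsFlagSum.mem_hookSchur [CharZero K] [NeZero k] {t : (⋀[K]^k V) ⊗[K] V} {r : ℕ}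
    (h : IsFlagSum t r) : t ∈ hookSchur K V k := by
  obtain ⟨c, p, -, rfl⟩ := h
  exact Submodule.sum_mem _ fun s _ => Submodule.smul_mem _ _ (flagTensor_mem _)

theorem IsFlagSum.add [NeZero k] {t t' : (⋀[K]^k V) ⊗[K] V} {r r' : ℕ}
    (h : IsFlagSum t r) (h' : IsFlagSum t' r') : IsFlagSum (t + t') (r + r') := by
  obtain ⟨c, p, hp, rfl⟩ := h
  obtain ⟨c', p', hp', rfl⟩ := h'
  refine ⟨Fin.append c c', Fin.append p p', fun s => ?_, ?_⟩
  · refine Fin.addCases (fun s => ?_) (fun s => ?_) s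
    · simpa using hp s
    · simpa using hp' s
  · simp [Fin.sum_univ_add]

theorem isFlagSum_one [NeZero k] (c : K) {p : Fin k → V} (hp : LinearIndependent K p) :
    IsFlagSum (c • (wedge K p ⊗ₜ[K] p 0)) 1 :=
  ⟨fun _ => c, fun _ => p, fun _ => hp, by simp⟩

theorem mk_mem_span_flagPoints_iff [CharZero K] [NeZero k] (t : (⋀[K]^k V) ⊗[K] V)
    (ht : t ∈ hookSchur K V k) (h0 : (⟨t, ht⟩ : hookSchur K V k) ≠ 0) (r : ℕ) :
    (∃ q : Fin r → ℙ K (hookSchur K V k), (∀ s, q s ∈ flagVariety K V k) ∧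
      Projectivization.mk K ⟨t, ht⟩ h0 ∈ Projectivization.Subspace.span (Set.range q)) ↔
      IsFlagSum t r := by
  have key : ∀ (p : Fin r → Fin k → V) (hp : ∀ s, LinearIndependent K (p s)),
      Projectivization.mk K ⟨t, ht⟩ h0 ∈ Projectivization.Subspace.span
        (Set.range fun s => flagPoint (p s) (hp s)) ↔
      ∃ c : Fin r → K, t = ∑ s, c s • (wedge K (p s) ⊗ₜ[K] p s 0) := by
    intro p hp
    refine (mk_mem_span_range_iff (K := K)
      (fun s => (⟨wedge K (p s) ⊗ₜ[K] p s 0, flagTensor_mem (p s)⟩ : hookSchur K V k))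
      (fun s h => flagTensor_ne_zero (p s) (hp s) (congrArg Subtype.val h)) h0).trans ?_
    rw [Submodule.mem_span_range_iff_exists_fun]
    refine exists_congr fun c => ?_
    rw [Subtype.ext_iff, eq_comm]
    refine Eq.congr_right ?_
    exact (map_sum (hookSchur K V k).subtype _ _).trans rfl
  constructor
  · rintro ⟨q, hq, hmem⟩
    choose p hp hpq using hq
    obtain rfl : q = fun s => flagPoint (p s) (hp s) := funext hpq
    obtain ⟨c, hc⟩ := (key p hp).1 hmem
    exact ⟨c, p, hp, hc⟩
  · rintro ⟨c, p, hp, hc⟩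
    exact ⟨fun s => flagPoint (p s) (hp s), fun s => ⟨p s, hp s, rfl⟩, (key p hp).2 ⟨c, hc⟩⟩

theorem hasHookRank_of_isFlagSum [CharZero K] [NeZero k] {t : (⋀[K]^k V) ⊗[K] V} {r : ℕ}
    (h0 : t ≠ 0) (h : IsFlagSum t r) (hlt : ∀ m < r, ¬ IsFlagSum t m) : HasHookRank t r := by
  refine ⟨h.mem_hookSchur, fun e => h0 (congrArg Subtype.val e), ?_⟩
  unfold xRank
  simp only [mk_mem_span_flagPoints_iff]
  refine le_antisymm (iInf₂_le r h) (le_iInf₂ fun m hm => ?_)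
  exact Nat.cast_le.2 (not_lt.1 fun hmr => hlt m hmr hm)

/-! ### Minors -/

/-- The functional on `⋀^k V` that sends `p_1 ∧ ⋯ ∧ p_k` to the determinant of `f_j (p_s)`. -/
noncomputable abbrev minor (f : Fin k → Module.Dual K V) : Module.Dual K (⋀[K]^k V) :=
  exteriorPower.alternatingMapToDual K V k f

theorem minor_wedge (f : Fin k → Module.Dual K V) (p : Fin k → V) :
    minor f (wedge K p) = Matrix.det (.of fun s j => f j (p s)) :=
  exteriorPower.alternatingMapToDual_apply_ιMulti f p

theorem minor_wedge_eq_one {f : Fin k → Module.Dual K V} {p : Fin k → V}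
    (h : ∀ s j, f j (p s) = if s = j then 1 else 0) : minor f (wedge K p) = 1 := by
  rw [minor_wedge, ← Matrix.det_one (n := Fin k)]
  congr 1
  ext s j
  rw [Matrix.of_apply, h, Matrix.one_apply]

theorem minor_wedge_eq_zero_of_functional {f : Fin k → Module.Dual K V} {p : Fin k → V} (j : Fin k)
    (h : ∀ s, f j (p s) = 0) : minor f (wedge K p) = 0 := by
  rw [minor_wedge]
  exact Matrix.det_eq_zero_of_column_eq_zero j h

theorem minor_wedge_eq_zero_of_vector {f : Fin k → Module.Dual K V} {p : Fin k → V} (s : Fin k)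
    (h : ∀ j, f j (p s) = 0) : minor f (wedge K p) = 0 := by
  rw [minor_wedge]
  exact Matrix.det_eq_zero_of_row_eq_zero s h

theorem linearIndependent_of_wedge_ne_zero {p : Fin k → V} (h : wedge K p ≠ 0) :
    LinearIndependent K p := by
  by_contra hp
  exact h (AlternatingMap.map_linearDependent (exteriorPower.ιMulti K k) p hp)

theorem linearIndependent_of_minor_ne_zero {p : Fin k → V} (f : Fin k → Module.Dual K V)
    (h : minor f (wedge K p) ≠ 0) : LinearIndependent K p :=
  linearIndependent_of_wedge_ne_zero fun e => h (by rw [e, map_zero])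

/-- A relation between the minors of a decomposable tensor: if `f_j` can be exchanged for `g` neither
at `i` nor at `i'` in a nonzero minor, then all the minors on `g` and the other `f_j` vanish. -/
theorem minor_update_update_eq_zero {f : Fin k → Module.Dual K V} {p : Fin k → V}
    {i i' : Fin k} (hii' : i ≠ i') {g : Module.Dual K V} (h0 : minor f (wedge K p) ≠ 0)
    (hi : minor (Function.update f i g) (wedge K p) = 0)
    (hi' : minor (Function.update f i' g) (wedge K p) = 0) (g' : Module.Dual K V) :
    minor (Function.update (Function.update f i g) i' g') (wedge K p) = 0 := by
  rw [minor_wedge] at h0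
  set M : Matrix (Fin k) (Fin k) K := .of fun s j => f j (p s) with hM
  have hu : IsUnit M.det := isUnit_iff_ne_zero.2 h0
  -- A nonzero minor makes the `f j` a basis of the dual of the span of the `p s`, so on that span
  -- `g` is a combination of them.
  obtain ⟨c, hc⟩ : ∃ c : Fin k → K, M.mulVec c = fun s => g (p s) :=
    ⟨M⁻¹.mulVec fun s => g (p s), by
      rw [Matrix.mulVec_mulVec, Matrix.mul_nonsing_inv _ hu, Matrix.one_mulVec]⟩
  have hg : ∀ s, g (p s) = (∑ j, c j • f j) (p s) := fun s => by
    rw [← congrFun hc s]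
    simp [Matrix.mulVec, dotProduct, hM, mul_comm]
  have hrep : ∀ (e : Fin k → Module.Dual K V) (l : Fin k),
      minor (Function.update e l g) (wedge K p) =
        ∑ j, c j * minor (Function.update e l (f j)) (wedge K p) := by
    intro e l
    have : minor (Function.update e l g) (wedge K p) =
        minor (Function.update e l (∑ j, c j • f j)) (wedge K p) := by
      rw [minor_wedge, minor_wedge]
      congr 1
      ext s j
      rcases eq_or_ne j l with rfl | hj
      · simpa using hg s
      · simp [hj]
    rw [this, minor, AlternatingMap.map_update_sum, LinearMap.sum_apply]
    refine Finset.sum_congr rfl fun j _ => ?_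
    rw [AlternatingMap.map_update_smul, LinearMap.smul_apply, smul_eq_mul]
  have hcoef : ∀ l, minor (Function.update f l g) (wedge K p) = c l * M.det := by
    intro l
    rw [hrep, Finset.sum_eq_single l]
    · rw [Function.update_eq_self, minor_wedge]
    · intro j _ hj
      rw [minor, AlternatingMap.map_update_self _ _ hj.symm, LinearMap.zero_apply, mul_zero]
    · simp
  -- Cramer's rule: the two vanishing minors are the coefficients `c i`, `c i'` times a unit. Every
  -- other `f j` still occupies slot `j`, so expanding `g` only gives minors with a repeated
  -- functional.
  have hci : c i = 0 := (mul_eq_zero.1 ((hcoef i).symm.trans hi)).resolve_right h0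
  have hci' : c i' = 0 := (mul_eq_zero.1 ((hcoef i').symm.trans hi')).resolve_right h0
  rw [Function.update_comm hii', hrep]
  refine Finset.sum_eq_zero fun j _ => ?_
  by_cases hj : j = i
  · rw [hj, hci, zero_mul]
  by_cases hj' : j = i'
  · rw [hj', hci', zero_mul]
  have : minor (Function.update (Function.update f i' g') i (f j)) = 0 :=
    AlternatingMap.map_eq_zero_of_eq _ _ (i := i) (j := j) (by simp [hj, hj']) (Ne.symm hj)
  rw [this, LinearMap.zero_apply, mul_zero]

/-! ### Lower bounds -/

/-- Contraction of the second factor of `M ⊗ V` with a functional. -/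
noncomputable def contract {M : Type*} [AddCommGroup M] [Module K M] (φ : Module.Dual K V) :
    M ⊗[K] V →ₗ[K] M :=
  (TensorProduct.rid K M).toLinearMap ∘ₗ LinearMap.lTensor M φ

theorem contract_tmul {M : Type*} [AddCommGroup M] [Module K M] (φ : Module.Dual K V) (P : M)
    (p : V) : contract φ (P ⊗ₜ[K] p) = φ p • P := by
  simp [contract]

variable {A B : ⋀[K]^k V} {x y : V} {φ ψ : Module.Dual K V}

/-- If the tensor were `P ⊗ p`, contraction with `φ` and `ψ` would make `A` and `B` both multiples
of `P`, whereas `F` kills `B ≠ 0` but not `A`. -/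
theorem not_isFlagSum_of_lt_two [NeZero k] (hφx : φ x = 1) (hφy : φ y = 0) (hψx : ψ x = 0)
    (hψy : ψ y = 1) (F : Module.Dual K (⋀[K]^k V)) (hFA : F A ≠ 0) (hFB : F B = 0) (hB : B ≠ 0) :
    ∀ m < 2, ¬ IsFlagSum (A ⊗ₜ[K] x + B ⊗ₜ[K] y) m := by
  have key : ∀ (P : ⋀[K]^k V) (p : V), A ⊗ₜ[K] x + B ⊗ₜ[K] y ≠ P ⊗ₜ[K] p := by
    intro P p h
    have h1 := congrArg (contract φ) h
    have h2 := congrArg (contract ψ) h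
    simp only [map_add, contract_tmul, hφx, hφy, hψx, hψy, one_smul, zero_smul, add_zero,
      zero_add] at h1 h2
    rw [h2, map_smul, smul_eq_mul] at hFB
    rw [h1, map_smul, smul_eq_mul] at hFA
    rcases mul_eq_zero.1 hFB with h | h
    · exact hB (by rw [h2, h, zero_smul])
    · exact hFA (by rw [h, mul_zero])
  rintro m hm ⟨c, p, -, h⟩
  interval_cases m
  · exact key 0 0 (by simpa using h)
  · exact key (c 0 • wedge K (p 0)) (p 0 0) (by simpa [TensorProduct.smul_tmul'] using h)

theorem not_isFlagSum_two [NeZero k] (hφx : φ x = 1) (hφy : φ y = 0) (hψx : ψ x = 0)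
    (hψy : ψ y = 1) (hB : B ≠ 0)
    (H : ∀ (p : Fin k → V) (c α β : K), c • wedge K p = α • A + β • B → α = 0) :
    ¬ IsFlagSum (A ⊗ₜ[K] x + B ⊗ₜ[K] y) 2 := by
  rintro ⟨c, p, -, h⟩
  rw [Fin.sum_univ_two] at h
  have h1 := congrArg (contract φ) h
  have h2 := congrArg (contract ψ) h
  simp only [map_add, map_smul, contract_tmul, hφx, hφy, hψx, hψy, one_smul, zero_smul, add_zero,
    zero_add] at h1 h2
  -- Eliminating one wedge between the two contractions leaves a multiple of the other, to which `H`
  -- applies.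
  have e0 : ψ (p 1 0) = 0 := H (p 0)
    (c 0 * (φ (p 0 0) * ψ (p 1 0) - φ (p 1 0) * ψ (p 0 0))) _ (-φ (p 1 0)) (by
      rw [h1, h2]; module)
  have e1 : ψ (p 0 0) = 0 := H (p 1)
    (c 1 * (φ (p 1 0) * ψ (p 0 0) - φ (p 0 0) * ψ (p 1 0))) _ (-φ (p 0 0)) (by
      rw [h1, h2]; module)
  exact hB (by rw [h2, e0, e1]; simp)

/-! ### Decompositions -/

/-- Polarization: the difference of the flag tensors with first vector `u 0 + y` and `u 0 - y` is
twice `hookSymm K u y`. As every `f s` kills `y`, both have the same nonzero minor as `u`. -/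
theorem isFlagSum_hookSymm [CharZero K] [NeZero k] {u : Fin k → V} {y : V}
    (f : Fin k → Module.Dual K V) (hu : minor f (wedge K u) ≠ 0) (hy : ∀ s, f s y = 0) (b : K) :
    IsFlagSum (b • hookSymm K u y) 2 := by
  have hy0 : minor f (wedge K (Function.update u 0 y)) = 0 :=
    minor_wedge_eq_zero_of_vector 0 (by simpa using hy)
  have hadd : wedge K (Function.update u 0 (u 0 + y)) =
      wedge K u + wedge K (Function.update u 0 y) := by
    rw [wedge, AlternatingMap.map_update_add, Function.update_eq_self]
  have hsub : wedge K (Function.update u 0 (u 0 - y)) =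
      wedge K u - wedge K (Function.update u 0 y) := by
    rw [wedge, AlternatingMap.map_update_sub, Function.update_eq_self]
  have h1 := isFlagSum_one (b * 2⁻¹) (p := Function.update u 0 (u 0 + y))
    (linearIndependent_of_minor_ne_zero f (by rwa [hadd, map_add, hy0, add_zero]))
  have h2 := isFlagSum_one (-(b * 2⁻¹)) (p := Function.update u 0 (u 0 - y))
    (linearIndependent_of_minor_ne_zero f (by rwa [hsub, map_sub, hy0, sub_zero]))
  have h3 := h1.add h2
  rw [hadd, hsub, Function.update_self, Function.update_self] at h3
  convert h3 using 1
  rw [hookSymm]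
  simp only [TensorProduct.tmul_add, TensorProduct.tmul_sub, TensorProduct.add_tmul,
    TensorProduct.sub_tmul]
  have h22 : (2⁻¹ : K) + 2⁻¹ = 1 := by norm_num
  have hb : b = b * 2⁻¹ + b * 2⁻¹ := by rw [← mul_add, h22, mul_one]
  conv_lhs => rw [hb]
  module

theorem tangentTensor_eq_add_hookSymm [NeZero k] (u : Fin k → V) (i : Fin k) (w y : V) (a b : K) :
    tangentTensor u i w y a b =
      a • (wedge K (Function.update u i w) ⊗ₜ[K] u 0) + b • hookSymm K u y := rfl

theorem tangentTensor_eq_tmul_add_tmul [NeZero k] (u : Fin k → V) (i : Fin k) (w y : V) (a b : K) :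
    tangentTensor u i w y a b =
      (a • wedge K (Function.update u i w) + b • wedge K (Function.update u 0 y)) ⊗ₜ[K] u 0 +
        (b • wedge K u) ⊗ₜ[K] y := by
  simp only [tangentTensor, TensorProduct.add_tmul, TensorProduct.smul_tmul', smul_add]
  abel

/-- If `w` is a multiple of `y`, then the first summand is absorbed by the second. -/
theorem tangentTensor_smul_eq [NeZero k] (u : Fin k → V) {i : Fin k} (hi : i ≠ 0) (c : K) (y : V)
    (a : K) {b : K} (hb : b ≠ 0) :
    tangentTensor u i (c • y) y a b =
      b • hookSymm K (Function.update u i (u i - (b⁻¹ * (a * c)) • u 0)) y := by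
  have hswap : wedge K (Function.update (Function.update u 0 y) i (u 0)) =
      -wedge K (Function.update u i y) := by
    have := AlternatingMap.map_swap (exteriorPower.ιMulti K k (M := V)) (Function.update u i y) hi
    rw [wedge, wedge, ← this]
    congr 1
    ext s
    rcases eq_or_ne s i with rfl | hs
    · simp [hi.symm]
    · rcases eq_or_ne s 0 with rfl | hs0
      · simp [hs]
      · simp [hs, hs0, Equiv.swap_apply_of_ne_of_ne hs hs0]
  have h1 : wedge K (Function.update u i (u i - (b⁻¹ * (a * c)) • u 0)) = wedge K u := by
    rw [wedge, AlternatingMap.map_update_sub, AlternatingMap.map_update_smul,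
      AlternatingMap.map_update_self _ _ hi, Function.update_eq_self, smul_zero, sub_zero]
  -- The correction has `y` in slot `0` and `u 0` in slot `i`; swapping them cancels the minus sign.
  have h2 : wedge K (Function.update (Function.update u i (u i - (b⁻¹ * (a * c)) • u 0)) 0 y) =
      wedge K (Function.update u 0 y) + (b⁻¹ * (a * c)) • wedge K (Function.update u i y) := by
    rw [Function.update_comm hi, wedge, AlternatingMap.map_update_sub,
      AlternatingMap.map_update_smul]
    change _ - (b⁻¹ * (a * c)) • wedge K (Function.update (Function.update u 0 y) i (u 0)) = _
    rw [hswap]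
    have : Function.update (Function.update u 0 y) i (u i) = Function.update u 0 y := by
      rw [Function.update_eq_self_iff, Function.update_of_ne hi]
    rw [this]
    module
  have h3 : wedge K (Function.update u i (c • y)) = c • wedge K (Function.update u i y) :=
    AlternatingMap.map_update_smul _ _ _ _ _
  rw [hookSymm, h1, h2, Function.update_of_ne hi.symm, tangentTensor, h3]
  simp only [TensorProduct.add_tmul, TensorProduct.smul_tmul', smul_add, smul_smul]
  rw [mul_inv_cancel_left₀ hb]
  abel

theorem wedge_tmul_comm [NeZero k] (u : Fin k → V) {i : Fin k} (hi : i ≠ 0) :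
    wedge K u ⊗ₜ[K] u i =
      (-1 : K) • (wedge K (u ∘ Equiv.swap 0 i) ⊗ₜ[K] (u ∘ Equiv.swap 0 i) 0) := by
  have := AlternatingMap.map_swap (exteriorPower.ιMulti K k (M := V)) u hi.symm
  rw [wedge, wedge, this, TensorProduct.smul_tmul', neg_smul, one_smul, neg_neg]
  simp

/-! ### Ranks -/

theorem hasHookRank_of_eq_tmul_add_tmul [CharZero K] [NeZero k] {t : (⋀[K]^k V) ⊗[K] V}
    (ht : t = A ⊗ₜ[K] x + B ⊗ₜ[K] y) (h2 : IsFlagSum t 2) (hφx : φ x = 1) (hφy : φ y = 0)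
    (hψx : ψ x = 0) (hψy : ψ y = 1) (F : Module.Dual K (⋀[K]^k V)) (hFA : F A ≠ 0) (hFB : F B = 0)
    (hB : B ≠ 0) : HasHookRank t 2 := by
  have hlt := not_isFlagSum_of_lt_two hφx hφy hψx hψy F hFA hFB hB
  rw [← ht] at hlt
  refine hasHookRank_of_isFlagSum (fun h0 => hlt 0 two_pos ?_) h2 hlt
  exact ⟨Fin.elim0, Fin.elim0, fun s => s.elim0, by simpa using h0⟩

end

/-! ### Decomposable elements in the span of `A` and `B` -/

section Rank

variable {K V : Type*} [Field K] [AddCommGroup V] [Module K V] {k : ℕ}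
  {u : Fin k → V} {e : Fin k → Module.Dual K V} {w y : V}
  {ω η : Module.Dual K V} {i : Fin k} {a b : K}

theorem minor_update_wedge_update (hu : ∀ s j, e j (u s) = if s = j then 1 else 0) (hw : ∀ s, e s w = 0)
    (hωu : ∀ s, ω (u s) = 0) (hωw : ω w = 1) (i : Fin k) :
    minor (Function.update e i ω) (wedge K (Function.update u i w)) = 1 := by
  refine minor_wedge_eq_one fun s j => ?_
  rcases eq_or_ne s i with rfl | hs
  · rcases eq_or_ne j s with rfl | hj
    · simp [hωw]
    · simp [hj, hj.symm, hw]
  · rcases eq_or_ne j i with rfl | hj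
    · simp [hs, hωu]
    · simp [hs, hj, hu]

/-- If `α ≠ 0`, the minor on `e` with `ω` in slot `i` is nonzero, and putting `η` in slot `0` or
slot `i` of it gives zero. The exchange relation then kills the minor on `e` with `η` in slot `0`,
which equals `α * b` on the right-hand side. -/
theorem eq_zero_of_smul_wedge_eq [NeZero k] (hi : i ≠ 0)
    (hu : ∀ s j, e j (u s) = if s = j then 1 else 0)
    (hw : ∀ s, e s w = 0) (hy : ∀ s, e s y = 0) (hωu : ∀ s, ω (u s) = 0) (hωw : ω w = 1)
    (hωy : ω y = 0) (hηu : ∀ s, η (u s) = 0) (hηw : η w = 0) (hηy : η y = 1)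
    (ha : a ≠ 0) (hb : b ≠ 0) {p : Fin k → V} {c α β : K}
    (h : c • wedge K p = α • (a • wedge K (Function.update u i w) +
      b • wedge K (Function.update u 0 y)) + β • (b • wedge K u)) : α = 0 := by
  by_contra hα
  have hηu0 : ∀ s, η (Function.update u i w s) = 0 := fun s => by
    rcases eq_or_ne s i with rfl | hs <;> simp [*]
  have hωuy : ∀ s, ω (Function.update u 0 y s) = 0 := fun s => by
    rcases eq_or_ne s 0 with rfl | hs <;> simp [*]
  have hval : ∀ f : Fin k → Module.Dual K V, c * minor f (wedge K p) =
      α * (a * minor f (wedge K (Function.update u i w)) +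
        b * minor f (wedge K (Function.update u 0 y))) + β * (b * minor f (wedge K u)) := by
    intro f
    simpa only [map_add, map_smul, smul_eq_mul] using congrArg (minor f) h
  have h1 := hval (Function.update e i ω)
  rw [minor_update_wedge_update hu hw hωu hωw, minor_wedge_eq_zero_of_functional i (p := Function.update u 0 y)
    (by simpa using hωuy), minor_wedge_eq_zero_of_functional i (p := u) (by simpa using hωu)] at h1
  have hc : c ≠ 0 := by
    rintro rfl
    simp [hα, ha] at h1
  have hp : minor (Function.update e i ω) (wedge K p) ≠ 0 := by
    intro h0
    simp [h0, hα, ha] at h1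
  have h2 := hval (Function.update (Function.update e i ω) 0 η)
  rw [minor_wedge_eq_zero_of_functional 0 (p := Function.update u i w) (by simpa using hηu0),
    minor_wedge_eq_zero_of_functional i (p := Function.update u 0 y) (by simpa [hi] using hωuy),
    minor_wedge_eq_zero_of_functional 0 (p := u) (by simpa using hηu)] at h2
  have h3 := hval (Function.update (Function.update e i ω) i η)
  rw [Function.update_idem,
    minor_wedge_eq_zero_of_functional i (p := Function.update u i w) (by simpa using hηu0),
    minor_wedge_eq_zero_of_functional 0 (p := Function.update u 0 y) (fun s => by
      rcases eq_or_ne s 0 with rfl | hs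
      · simp [hi.symm, hy]
      · simp [hi.symm, hs, hu]),
    minor_wedge_eq_zero_of_functional i (p := u) (by simpa using hηu)] at h3
  have h4 := hval (Function.update (Function.update (Function.update e i ω) 0 η) i (e i))
  rw [minor_update_update_eq_zero hi.symm hp (by simpa [hc] using h2)
    (by rw [Function.update_idem]; simpa [hc] using h3), Function.update_comm hi.symm,
    Function.update_idem, Function.update_eq_self, minor_update_wedge_update hu hy hηu hηy,
    minor_wedge_eq_zero_of_functional 0 (p := Function.update u i w) (by simpa using hηu0),
    minor_wedge_eq_zero_of_functional 0 (p := u) (by simpa using hηu)] at h4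
  simp [hα, hb] at h4

end Rank

theorem mainTheorem8 {K V : Type*} [Field K] [IsAlgClosed K] [CharZero K]
    [AddCommGroup V] [Module K V] {n k : ℕ} [NeZero k] (hk : 2 ≤ k) (hkn : k < n)
    (v : Module.Basis (Fin n) K V)
    (u : Fin k → V) (hu : ∀ s : Fin k, u s = v (Fin.castLE hkn.le s))
    (i : Fin k) (hi : i ≠ 0)
    (h : Fin n) (hh : 1 ≤ (h : ℕ))
    (w : V) (hw : w ∈ Submodule.span K (v '' {l : Fin n | k ≤ (l : ℕ)})) (hw0 : w ≠ 0)
    (a b : K) (ha : a ≠ 0) (hb : b ≠ 0) :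
    (LinearIndependent K ![w, v h] → v h ∈ Submodule.span K (u '' {s : Fin k | s ≠ 0}) →
      HasHookRank (tangentTensor u i w (v h) a b) 2) ∧
    (LinearIndependent K ![w, v h] → v h ∉ Submodule.span K (u '' {s : Fin k | s ≠ 0}) →
      HasHookRank (tangentTensor u i w (v h) a b) 3) ∧
    (¬ LinearIndependent K ![w, v h] →
      HasHookRank (tangentTensor u i w (v h) a b) 2) := by
  let e : Fin k → Module.Dual K V := fun s => v.coord (Fin.castLE hkn.le s)
  have heu : ∀ s j, e j (u s) = if s = j then 1 else 0 := fun s j => by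
    simp [e, hu, Finsupp.single_apply]
  have hwl : ∀ l : Fin n, (l : ℕ) < k → v.coord l w = 0 := by
    intro l hl
    have := v.mem_span_image.1 hw
    by_contra h0
    exact absurd (this (Finsupp.mem_support_iff.2 h0)) (not_le.2 hl)
  have hew : ∀ s, e s w = 0 := fun s => hwl _ s.2
  have hyk : v h ∉ Submodule.span K (u '' {s : Fin k | s ≠ 0}) → k ≤ (h : ℕ) := by
    intro hy
    by_contra! hlt
    refine hy (Submodule.subset_span ⟨⟨h, hlt⟩, fun h0 => ?_, hu _⟩)
    have := congrArg Fin.val h0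
    simp at this
    omega
  have hey : k ≤ (h : ℕ) → ∀ s, e s (v h) = 0 := by
    intro hle s
    have : h ≠ Fin.castLE hkn.le s := fun h0 => by
      have := congrArg Fin.val h0
      simp at this
      omega
    simp [e, this]
  have hηu : k ≤ (h : ℕ) → ∀ s, v.coord h (u s) = 0 := fun hle s => by
    have : Fin.castLE hkn.le s ≠ h := fun h0 => by
      have := congrArg Fin.val h0
      simp at this
      omega
    simp [hu, this]
  have hu0 : minor e (wedge K u) = 1 := minor_wedge_eq_one heu
  have hB : b • wedge K u ≠ 0 := fun h0 => by
    have := congrArg (minor e) h0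
    simp [hu0, hb] at this
  have h0h : Fin.castLE hkn.le 0 ≠ h := fun h0 => by
    have := congrArg Fin.val h0
    simp at this
    omega
  have hφx : v.coord (Fin.castLE hkn.le 0) (u 0) = 1 := by simp [hu]
  have hφy : v.coord (Fin.castLE hkn.le 0) (v h) = 0 := by
    simp [h0h.symm]
  have hψx : v.coord h (u 0) = 0 := by simp [hu, h0h]
  have hψy : v.coord h (v h) = 1 := by simp
  have hω : LinearIndependent K ![w, v h] → ∃ ω : Module.Dual K V,
      (∀ s, ω (u s) = 0) ∧ ω w = 1 ∧ ω (v h) = 0 := by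
    intro hli
    -- Since `w` is not a multiple of `v h`, it has another nonzero coordinate; as `w` only involves
    -- indices at least `k`, that coordinate vanishes on every `u s`.
    obtain ⟨l, hlh, hl0⟩ : ∃ l, l ≠ h ∧ v.coord l w ≠ 0 := by
      by_contra! hall
      have hwh : w = v.coord h w • v h := by
        apply v.ext_elem
        intro l
        rcases eq_or_ne l h with rfl | hl
        · simp
        · simpa [Finsupp.single_apply, hl.symm] using hall l hl
      have := LinearIndependent.pair_iff.1 hli 1 (-v.coord h w) (by
        rw [one_smul, neg_smul, ← hwh, add_neg_cancel])
      exact one_ne_zero this.1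
    refine ⟨(v.coord l w)⁻¹ • v.coord l, fun s => ?_, ?_, ?_⟩
    · have : Fin.castLE hkn.le s ≠ l := fun h0 => hl0 (hwl l (h0 ▸ s.2))
      simp [hu, this]
    · simpa using inv_mul_cancel₀ hl0
    · simp [hlh.symm]
  have hflag : LinearIndependent K ![w, v h] →
      IsFlagSum (a • (wedge K (Function.update u i w) ⊗ₜ[K] u 0)) 1 := by
    intro hli
    obtain ⟨ω, hωu, hωw, -⟩ := hω hli
    have hp := linearIndependent_of_minor_ne_zero (Function.update e i ω)
      (by rw [minor_update_wedge_update heu hew hωu hωw i]; exact one_ne_zero)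
    have := isFlagSum_one a hp
    rwa [Function.update_of_ne hi.symm] at this
  have hωA : ∀ ω : Module.Dual K V, (∀ s, ω (u s) = 0) → ω w = 1 → ω (v h) = 0 →
      minor (Function.update e i ω) (a • wedge K (Function.update u i w) +
        b • wedge K (Function.update u 0 (v h))) ≠ 0 ∧
      minor (Function.update e i ω) (b • wedge K u) = 0 := by
    intro ω hωu hωw hωy
    have h1 : minor (Function.update e i ω) (wedge K (Function.update u 0 (v h))) = 0 := by
      refine minor_wedge_eq_zero_of_functional i fun s => ?_
      rcases eq_or_ne s 0 with rfl | hs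
      · simpa using hωy
      · simpa [hs] using hωu s
    have h2 : minor (Function.update e i ω) (wedge K u) = 0 :=
      minor_wedge_eq_zero_of_functional i (by simpa using hωu)
    rw [map_add, map_smul, map_smul, map_smul, h1, h2, minor_update_wedge_update heu hew hωu hωw]
    simpa using ha
  refine ⟨fun hli hy => ?_, fun hli hy => ?_, fun hli => ?_⟩
  · obtain ⟨ω, hωu, hωw, hωy⟩ := hω hli
    obtain ⟨hFA, hFB⟩ := hωA ω hωu hωw hωy
    obtain ⟨j, hj0, hj⟩ : ∃ j : Fin k, j ≠ 0 ∧ v h = u j := by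
      have huv : u '' {s : Fin k | s ≠ 0} = v '' (Fin.castLE hkn.le '' {s : Fin k | s ≠ 0}) := by
        rw [Set.image_image]
        exact Set.image_congr fun s _ => hu s
      rw [huv] at hy
      obtain ⟨j, hj, hjh⟩ := v.mem_span_image.1 hy (show h ∈ (v.repr (v h)).support by simp)
      exact ⟨j, hj, by rw [hu, hjh]⟩
    refine hasHookRank_of_eq_tmul_add_tmul (tangentTensor_eq_tmul_add_tmul u i w (v h) a b) ?_
      hφx hφy hψx hψy _ hFA hFB hB
    have hzero : wedge K (Function.update u 0 (u j)) = 0 :=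
      AlternatingMap.map_update_self _ _ hj0.symm
    rw [tangentTensor_eq_add_hookSymm, hookSymm, hj, hzero, TensorProduct.zero_tmul, add_zero,
      wedge_tmul_comm u hj0, smul_smul]
    refine (hflag hli).add (isFlagSum_one (b * -1) ?_)
    exact (linearIndependent_of_minor_ne_zero e (by simp [hu0])).comp _ (Equiv.injective _)
  · obtain ⟨ω, hωu, hωw, hωy⟩ := hω hli
    obtain ⟨hFA, hFB⟩ := hωA ω hωu hωw hωy
    have hle := hyk hy
    have hlt := not_isFlagSum_of_lt_two hφx hφy hψx hψy _ hFA hFB hB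
    rw [← tangentTensor_eq_tmul_add_tmul] at hlt
    refine hasHookRank_of_isFlagSum (fun h0 => hlt 0 two_pos ?_)
      ((hflag hli).add (isFlagSum_hookSymm e (by simp [hu0]) (hey hle) b)) fun m hm => ?_
    · exact ⟨Fin.elim0, Fin.elim0, fun s => s.elim0, by simpa using h0⟩
    · rcases (Nat.lt_succ_iff.1 hm).lt_or_eq with hm | rfl
      · exact hlt m hm
      · rw [tangentTensor_eq_tmul_add_tmul]
        refine not_isFlagSum_two hφx hφy hψx hψy hB fun p c α β hp => ?_
        -- Subtracting the multiple of `ω` makes `η` vanish at `w` without changing its values at `v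
        -- h` and the `u s`.
        exact eq_zero_of_smul_wedge_eq (η := v.coord h - v.coord h w • ω) hi heu hew (hey hle) hωu
          hωw hωy (fun s => by simp [hωu, -Module.Basis.coord_apply, hηu hle])
          (by simp [hωw]) (by simp [hωy]) ha hb hp
  · obtain ⟨c, hc0, rfl⟩ : ∃ c : K, c ≠ 0 ∧ w = c • v h := by
      rw [LinearIndependent.pair_iff' hw0] at hli
      push Not at hli
      obtain ⟨c, hc⟩ := hli
      have hc0 : c ≠ 0 := by
        rintro rfl
        exact v.ne_zero h (by rw [← hc, zero_smul])
      exact ⟨c⁻¹, inv_ne_zero hc0, by rw [← hc, inv_smul_smul₀ hc0]⟩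
    have hle : k ≤ (h : ℕ) := by
      by_contra! hlt
      have := hwl h hlt
      simp [hc0] at this
    have h2 : IsFlagSum (tangentTensor u i (c • v h) (v h) a b) 2 := by
      rw [tangentTensor_smul_eq u hi c (v h) a hb]
      refine isFlagSum_hookSymm e ?_ (hey hle) b
      rw [wedge, AlternatingMap.map_update_sub, AlternatingMap.map_update_smul,
        AlternatingMap.map_update_self _ _ hi, Function.update_eq_self, smul_zero, sub_zero, hu0]
      exact one_ne_zero
    -- Here the `v h` wedge in `A` is the one detected: with the coordinate of `v h` in slot `0`,
    -- all functionals of the minor kill `u 0`, hence also the `w` wedge.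
    refine hasHookRank_of_eq_tmul_add_tmul (tangentTensor_eq_tmul_add_tmul u i _ (v h) a b) h2
      hφx hφy hψx hψy (minor (Function.update e 0 (v.coord h))) ?_ ?_ hB
    · have h1 : minor (Function.update e 0 (v.coord h)) (wedge K (Function.update u i (c • v h))) =
          0 := by
        refine minor_wedge_eq_zero_of_vector 0 fun j => ?_
        rcases eq_or_ne j 0 with rfl | hj
        · simpa [hi.symm] using hψx
        · simp [hi.symm, hj, hj.symm, heu]
      rw [map_add, map_smul, map_smul, h1, minor_update_wedge_update heu (hey hle) (hηu hle) hψy 0]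
      simpa using hb
    · rw [map_smul, minor_wedge_eq_zero_of_functional 0 (by simpa using hηu hle), smul_zero]
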